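/- Let $Q\subset\mathbb R^n$ be a cube (with sides parallel to the axes) and let $f$ be a measurable real- or complex-valued function on $Q$. Let $\lambda_f(s)=|\{x\in Q:|f(x)|>s\}|$, $f^{*}(t)=\inf\{s\ge 0:\lambda_f(s)\le t\}$ and $f^{**}(t)=\frac1t\int_0^t f^{*}(s)\,ds$ for $t>0$, and put $$\|f\|_{L(\infty,\infty)}=\sup_{t>0}\bigl(f^{**}(t)-f^{*}(t)\bigr)\in[0,\infty],\qquad \|f\|_{e^L}=\inf\Bigl\{k>0:\int_Q\bigl(e^{|f(x)|/k}-1\bigr)\,dx\le 1\Bigr\}\in[0,\infty].$$ The supremum is over all $t\in(0,\infty)$, including $t\ge|Q|$, where $f^*(t)=0$. All $L^q$ norms are over $Q$ with Lebesgue measure, and all norms may be infinite. There is an absolute constant $c<\infty$ (independent of $n$, $Q$, $f$ and $q$) such that, for all such $n$, $Q$ and $f$: 1. $\|f\|_{L^1}\le |Q|\,\|f\|_{L(\infty,\infty)}$. 2. For every real $q>1$, $$\|f\|_{L^q}\le c\,q\,\|f\|_{L^1}^{1/q}\,\|f\|_{L(\infty,\infty)}^{1-1/q},\qquad \|f\|_{L^q}\le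 c\,q\,|Q|^{1/q}\,\|f\|_{L(\infty,\infty)},$$ and consequently $\|f\|_{L^q}\le c_Q\,q\,\|f\|_{L(\infty,\infty)}$, where $c_Q=c\max(1,|Q|)$. 3. $\|f\|_{e^L}\le c\,\sup_{q>1}\frac{\|f\|_{L^q}}{q}$ and $\sup_{q>1}\frac{\|f\|_{L^q}}{q}\le c\,\|f\|_{e^L}$. 4. $\sup_{q>1}\frac{\|f\|_{L^q}}{q}\le c_Q\,\|f\|_{L(\infty,\infty)}$, and hence $\|f\|_{e^L}\le c_Q\,\|f\|_{L(\infty,\infty)}$. -/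

import Mathlib

open MeasureTheory
open scoped NNReal ENNReal

namespace Oscillation

noncomputable section

/-- The closed cube in `ℝⁿ` with lower corner `a`, side length `ℓ` and sides parallel to the axes. -/
def cube {n : ℕ} (a : EuclideanSpace ℝ (Fin n)) (ℓ : ℝ) : Set (EuclideanSpace ℝ (Fin n)) :=
  {x | ∀ i, x i ∈ Set.Icc (a i) (a i + ℓ)}

variable {α E : Type*} [MeasurableSpace α] [NormedAddCommGroup E]

/-- The distribution function `λ_f(s) = μ {x : |f x| > s}`. -/
def distribution (f : α → E) (μ : Measure α) (s : ℝ≥0∞) : ℝ≥0∞ :=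
  μ {x | s < ‖f x‖ₑ}

/-- The non-increasing rearrangement `f^*(t) = inf {s : λ_f(s) ≤ t}`, for `t > 0`. -/
def rearrangement (f : α → E) (μ : Measure α) (t : ℝ) : ℝ≥0∞ :=
  sInf {s : ℝ≥0∞ | distribution f μ s ≤ ENNReal.ofReal t}

/-- The averaged rearrangement `f^{**}(t) = (1/t) ∫₀ᵗ f^*(s) ds`, for `t > 0`. -/
def avgRearrangement (f : α → E) (μ : Measure α) (t : ℝ) : ℝ≥0∞ :=
  (∫⁻ s in Set.Ioo 0 t, rearrangement f μ s) / ENNReal.ofReal t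

/-- `‖f‖_{L(∞,∞)} = sup_{t > 0} (f^{**}(t) - f^*(t))`, with values in `[0, ∞]`.
The subtraction in `[0, ∞]` is the true one: `f^*(t) ≤ f^{**}(t)`, and on a space of finite measure
`f^*(t) < ∞` for every `t > 0`. The supremum is over all `t > 0`, also those beyond the measure of
the space, where `f^*` vanishes. -/
def oscNorm (f : α → E) (μ : Measure α) : ℝ≥0∞ :=
  ⨆ (t : ℝ) (_ : 0 < t), (avgRearrangement f μ t - rearrangement f μ t)

/-- The Luxemburg norm of the Orlicz space `e^L`, with Young function `u ↦ e^u - 1`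
(it is `∞` if no `k` is admissible). -/
def expNorm (f : α → E) (μ : Measure α) : ℝ≥0∞ :=
  ⨅ (k : ℝ) (_ : 0 < k ∧ ∫⁻ x, ENNReal.ofReal (Real.exp (‖f x‖ / k) - 1) ∂μ ≤ 1),
    ENNReal.ofReal k

/-- The extrapolation norm `sup_{q > 1} ‖f‖_{L^q} / q`. -/
def extrapolationNorm (f : α → E) (μ : Measure α) : ℝ≥0∞ :=
  ⨆ (q : ℝ) (_ : 1 < q), eLpNorm f (ENNReal.ofReal q) μ / ENNReal.ofReal q

end

end Oscillation

namespace Oscillation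

variable {α E : Type*} [MeasurableSpace α] [NormedAddCommGroup E]

/-! Write `W` for `oscNorm f μ`. Taking `t = μ {|f| > s}` in the supremum gives `f^*(t) ≤ s`, while
the integral of `|f|` over `{|f| > s}` is at most `t f^{**}(t)`; hence `∫ (|f| - s)₊ ≤ W μ {|f| >
s}` for every `s ≥ 0` (`lintegral_ofReal_norm_sub_le`). This is the only way `W` enters. Integrating
against `s^k ds` turns it into `∫ |f|^(k+2) ≤ (k+2) W ∫ |f|^(k+1)`, so the integer moments grow like
`(k+1)! W^k ‖f‖₁`. Factorial moments give `L^q` norms linear in `q`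
(`eLpNorm_le_of_lintegral_pow_le`). The comparison of `e^L` with the extrapolation norm is the
Taylor series of `e^y - 1`: in one direction `m^m / m! ≤ 3^m` sums it, in the other each single term
is bounded by the whole, which again yields factorial moments. -/

/-! ### Rearrangements and integrals over sets of given measure -/

theorem rearrangement_antitone (f : α → E) (μ : Measure α) : Antitone (rearrangement f μ) :=
  fun _ _ h => sInf_le_sInf fun _ hs => le_trans hs (ENNReal.ofReal_le_ofReal h)

theorem rearrangement_le {f : α → E} {μ : Measure α} {t : ℝ} {s : ℝ≥0∞}
    (h : distribution f μ s ≤ ENNReal.ofReal t) : rearrangement f μ t ≤ s :=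
  sInf_le h

theorem distribution_antitone (f : α → E) (μ : Measure α) : Antitone (distribution f μ) :=
  fun _ _ h => measure_mono fun _ hx => lt_of_le_of_lt h hx

theorem le_rearrangement {f : α → E} {μ : Measure α} {t : ℝ} {s : ℝ≥0∞}
    (h : ENNReal.ofReal t < distribution f μ s) : s ≤ rearrangement f μ t := by
  refine le_sInf fun r hr => ?_
  by_contra! hrs
  exact absurd (h.trans_le ((distribution_antitone f μ hrs.le).trans hr)) (lt_irrefl _)

theorem volume_setOf_ofReal_le_le (y : ℝ≥0∞) :
    volume.restrict (Set.Ioi 0) {u : ℝ | ENNReal.ofReal u ≤ y} ≤ y := by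
  rcases eq_or_ne y ⊤ with rfl | hy
  · exact le_top
  rw [Measure.restrict_apply' measurableSet_Ioi]
  calc _ ≤ volume (Set.Ioc 0 y.toReal) := by
        refine measure_mono fun u hu => ⟨hu.2, ?_⟩
        exact (ENNReal.ofReal_le_iff_le_toReal hy).1 hu.1
    _ = y := by simp [hy]

/-- Among the sets of measure at most `t`, none carries more mass of `f` than `f^*` has
on `(0, t)`. -/
theorem setLIntegral_enorm_le_lintegral_rearrangement {f : α → E} {μ : Measure α}
    (hf : AEStronglyMeasurable f μ) {A : Set α} {t : ℝ} (hA : μ A ≤ ENNReal.ofReal t) :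
    ∫⁻ x in A, ‖f x‖ₑ ∂μ ≤ ∫⁻ s in Set.Ioo 0 t, rearrangement f μ s := by
  have hmeas : Measurable (rearrangement f μ) := (rearrangement_antitone f μ).measurable
  have hS : MeasurableSet {p : ℝ × ℝ | ENNReal.ofReal p.2 ≤ rearrangement f μ p.1} :=
    measurableSet_le (by fun_prop) (by fun_prop)
  have h1 : ∫⁻ x in A, ‖f x‖ₑ ∂μ
      = ∫⁻ u in Set.Ioi (0 : ℝ), μ.restrict A {x | u < ‖f x‖} := by
    rw [← lintegral_eq_lintegral_meas_lt (μ.restrict A) (f := fun x => ‖f x‖)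
      (ae_of_all _ fun _ => norm_nonneg _) hf.restrict.norm.aemeasurable]
    simp only [ofReal_norm]
  -- Layer cake in the level `u`: the part of `A` above level `u` has measure at most `min t
  -- (λ_f(u))`, and every positive `s` below that number satisfies `u ≤ f^*(s)`. Tonelli then
  -- integrates in `u` first, where `{u > 0 : u ≤ f^*(s)}` has length at most `f^*(s)`.
  have h2 : ∀ u ∈ Set.Ioi (0 : ℝ), μ.restrict A {x | u < ‖f x‖} ≤
      ∫⁻ s in Set.Ioo 0 t, {p : ℝ × ℝ | ENNReal.ofReal p.2 ≤ rearrangement f μ p.1}.indicator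
        1 (s, u) := by
    intro u hu
    have hms : MeasurableSet {s : ℝ | ENNReal.ofReal u ≤ rearrangement f μ s} :=
      measurableSet_le measurable_const hmeas
    have : ∀ s, {p : ℝ × ℝ | ENNReal.ofReal p.2 ≤ rearrangement f μ p.1}.indicator
        (1 : ℝ × ℝ → ℝ≥0∞) (s, u)
        = {s : ℝ | ENNReal.ofReal u ≤ rearrangement f μ s}.indicator 1 s := fun s => rfl
    simp only [this]
    rw [lintegral_indicator_one hms, Measure.restrict_apply hms]
    set m := min (ENNReal.ofReal t) (distribution f μ (ENNReal.ofReal u)) with hm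
    have hmt : m ≠ ⊤ := ne_top_of_le_ne_top ENNReal.ofReal_ne_top (min_le_left _ _)
    calc μ.restrict A {x | u < ‖f x‖} ≤ m := by
          refine le_min ?_ ?_
          · exact (measure_mono (Set.subset_univ _)).trans (by simpa using hA)
          · refine (Measure.restrict_le_self _).trans (measure_mono fun x hx => ?_)
            change ENNReal.ofReal u < ‖f x‖ₑ
            rw [← ofReal_norm]
            exact (ENNReal.ofReal_lt_ofReal_iff_of_nonneg (le_of_lt hu)).2 hx
      _ = volume (Set.Ioo 0 m.toReal) := by simp [hmt]
      _ ≤ _ := by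
          refine measure_mono fun s hs => ?_
          have hsm : ENNReal.ofReal s < m := by
            rw [ENNReal.ofReal_lt_iff_lt_toReal hs.1.le hmt]; exact hs.2
          refine ⟨le_rearrangement (hsm.trans_le (min_le_right _ _)), hs.1, ?_⟩
          exact (ENNReal.ofReal_lt_ofReal_iff'.1 (hsm.trans_le (min_le_left _ _))).1
  rw [h1]
  refine (setLIntegral_mono' measurableSet_Ioi h2).trans ?_
  rw [lintegral_lintegral_swap]
  · refine lintegral_mono fun s => ?_
    have hms : MeasurableSet {u : ℝ | ENNReal.ofReal u ≤ rearrangement f μ s} :=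
      measurableSet_le (by fun_prop) measurable_const
    have : ∀ u, {p : ℝ × ℝ | ENNReal.ofReal p.2 ≤ rearrangement f μ p.1}.indicator
        (1 : ℝ × ℝ → ℝ≥0∞) (s, u)
        = {u : ℝ | ENNReal.ofReal u ≤ rearrangement f μ s}.indicator 1 u := fun s => rfl
    simp only [this]
    rw [lintegral_indicator_one hms]
    exact volume_setOf_ofReal_le_le _
  · exact ((measurable_const.indicator hS).comp measurable_swap).aemeasurable

/-! ### The level-set inequality -/

/-- The defining supremum is tested at `t = μ A`, the measure of the level set itself, where `f^*(t)
≤ s`. -/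
theorem setLIntegral_enorm_le_oscNorm {f : α → E} {μ : Measure α} [IsFiniteMeasure μ]
    (hf : AEStronglyMeasurable f μ) (s : ℝ≥0∞) :
    ∫⁻ x in {x | s < ‖f x‖ₑ}, ‖f x‖ₑ ∂μ
      ≤ s * μ {x | s < ‖f x‖ₑ} + oscNorm f μ * μ {x | s < ‖f x‖ₑ} := by
  set A := {x | s < ‖f x‖ₑ} with hAdef
  rcases eq_or_ne (μ A) 0 with h0 | h0
  · simp [Measure.restrict_eq_zero.2 h0]
  have htop : μ A ≠ ⊤ := measure_ne_top _ _
  have ht : 0 < (μ A).toReal := ENNReal.toReal_pos h0 htop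
  have hof : ENNReal.ofReal (μ A).toReal = μ A := ENNReal.ofReal_toReal htop
  have h1 : avgRearrangement f μ (μ A).toReal
      ≤ rearrangement f μ (μ A).toReal + oscNorm f μ := by
    rw [← tsub_le_iff_left]
    exact le_iSup₂_of_le (μ A).toReal ht le_rfl
  have h2 : rearrangement f μ (μ A).toReal ≤ s := rearrangement_le (by rw [hof]; rfl)
  have h3 := setLIntegral_enorm_le_lintegral_rearrangement hf hof.ge
  have h4 : (∫⁻ s in Set.Ioo 0 (μ A).toReal, rearrangement f μ s) / μ A
      ≤ s + oscNorm f μ := by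
    have := h1.trans (add_le_add_left h2 _)
    rwa [avgRearrangement, hof] at this
  rw [ENNReal.div_le_iff h0 htop] at h4
  rw [← add_mul]
  exact h3.trans h4

theorem lintegral_enorm_le_oscNorm {f : α → E} {μ : Measure α} [IsFiniteMeasure μ]
    (hf : AEStronglyMeasurable f μ) :
    ∫⁻ x, ‖f x‖ₑ ∂μ ≤ μ Set.univ * oscNorm f μ := by
  have hA : NullMeasurableSet {x | 0 < ‖f x‖ₑ} μ :=
    nullMeasurableSet_lt aemeasurable_const hf.enorm
  calc ∫⁻ x, ‖f x‖ₑ ∂μ = ∫⁻ x in {x | 0 < ‖f x‖ₑ}, ‖f x‖ₑ ∂μ := by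
        rw [← lintegral_indicator₀ hA]
        refine lintegral_congr fun x => ?_
        by_cases hx : 0 < ‖f x‖ₑ
        · rw [Set.indicator_of_mem (s := {x | 0 < ‖f x‖ₑ}) hx]
        · rw [Set.indicator_of_notMem (s := {x | 0 < ‖f x‖ₑ}) hx]
          exact le_antisymm (not_lt.1 hx) bot_le
    _ ≤ oscNorm f μ * μ {x | 0 < ‖f x‖ₑ} := by
        simpa using setLIntegral_enorm_le_oscNorm hf 0
    _ ≤ _ := by
        rw [mul_comm]
        gcongr
        exact Set.subset_univ _

theorem lintegral_ofReal_norm_sub_le {f : α → E} {μ : Measure α} [IsFiniteMeasure μ]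
    (hf : AEStronglyMeasurable f μ) {s : ℝ} (hs : 0 ≤ s) :
    ∫⁻ x, ENNReal.ofReal (‖f x‖ - s) ∂μ ≤ oscNorm f μ * μ {x | s < ‖f x‖} := by
  have hset : {x | ENNReal.ofReal s < ‖f x‖ₑ} = {x | s < ‖f x‖} := by
    ext x
    simp only [Set.mem_ofPred_eq]
    rw [← ofReal_norm, ENNReal.ofReal_lt_ofReal_iff_of_nonneg hs]
  have hA : NullMeasurableSet {x | s < ‖f x‖} μ :=
    nullMeasurableSet_lt aemeasurable_const hf.norm.aemeasurable
  have h := setLIntegral_enorm_le_oscNorm hf (ENNReal.ofReal s)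
  rw [hset] at h
  -- Finiteness of `s μ {|f| > s}` is what allows it to be cancelled from both sides.
  have hfin : ENNReal.ofReal s * μ {x | s < ‖f x‖} ≠ ⊤ :=
    ENNReal.mul_ne_top ENNReal.ofReal_ne_top (measure_ne_top _ _)
  refine (ENNReal.add_le_add_iff_left hfin).1 (le_trans (le_of_eq ?_) h)
  rw [← lintegral_indicator_const₀ hA, ← lintegral_add_left' (aemeasurable_const.indicator₀ hA),
    ← lintegral_indicator₀ hA]
  refine lintegral_congr fun x => ?_
  by_cases hx : s < ‖f x‖
  · rw [Set.indicator_of_mem (s := {x | s < ‖f x‖}) hx,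
      Set.indicator_of_mem (s := {x | s < ‖f x‖}) hx,
      ← ENNReal.ofReal_add hs (sub_nonneg.2 hx.le), add_sub_cancel, ofReal_norm]
  · rw [Set.indicator_of_notMem (s := {x | s < ‖f x‖}) hx,
      Set.indicator_of_notMem (s := {x | s < ‖f x‖}) hx,
      ENNReal.ofReal_of_nonpos (sub_nonpos.2 (not_lt.1 hx)), add_zero]

/-! ### Factorial growth of the integer moments -/

theorem lintegral_pow_mul_ofReal_sub {y : ℝ} (hy : 0 ≤ y) (k : ℕ) :
    ENNReal.ofReal (y ^ (k + 2)) = (k + 2) * ((k + 1) *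
      ∫⁻ s in Set.Ioi (0 : ℝ), ENNReal.ofReal (s ^ k) * ENNReal.ofReal (y - s)) := by
  have h1 : ∫⁻ s in Set.Ioi (0 : ℝ), ENNReal.ofReal (s ^ k) * ENNReal.ofReal (y - s)
      = ∫⁻ s in Set.Ioc 0 y, ENNReal.ofReal (s ^ k * (y - s)) := by
    rw [← lintegral_indicator measurableSet_Ioi, ← lintegral_indicator measurableSet_Ioc]
    refine lintegral_congr fun s => ?_
    by_cases hs : 0 < s
    · rw [Set.indicator_of_mem (s := Set.Ioi 0) hs]
      by_cases hsy : s ≤ y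
      · rw [Set.indicator_of_mem (s := Set.Ioc 0 y) ⟨hs, hsy⟩, ENNReal.ofReal_mul (by positivity)]
      · rw [Set.indicator_of_notMem (s := Set.Ioc 0 y) (fun h => hsy h.2),
          ENNReal.ofReal_of_nonpos (sub_nonpos.2 (not_le.1 hsy).le), mul_zero]
    · rw [Set.indicator_of_notMem (s := Set.Ioi 0) hs,
        Set.indicator_of_notMem (s := Set.Ioc 0 y) (fun h => hs h.1)]
  have hint : IntervalIntegrable (fun s : ℝ => s ^ k * (y - s)) volume 0 y :=
    (by fun_prop : Continuous fun s : ℝ => s ^ k * (y - s)).intervalIntegrable _ _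
  have hval : ∫ s in (0 : ℝ)..y, s ^ k * (y - s) = y ^ (k + 2) / ((k + 1) * (k + 2)) := by
    have : ∀ s : ℝ, s ^ k * (y - s) = s ^ k * y - s ^ (k + 1) := fun s => by ring
    simp only [this]
    rw [intervalIntegral.integral_sub (by apply Continuous.intervalIntegrable; fun_prop)
      (by apply Continuous.intervalIntegrable; fun_prop), intervalIntegral.integral_mul_const,
      integral_pow, integral_pow]
    push_cast
    have : (k : ℝ) + 1 ≠ 0 := by positivity
    have : (k : ℝ) + 1 + 1 ≠ 0 := by positivity
    have : (k : ℝ) + 2 ≠ 0 := by positivity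
    simp
    field_simp
    ring
  rw [h1, ← ofReal_integral_eq_lintegral_ofReal
    ((intervalIntegrable_iff_integrableOn_Ioc_of_le hy).1 hint)
    ((ae_restrict_iff' measurableSet_Ioc).2 (ae_of_all _ fun s hs =>
      mul_nonneg (pow_nonneg hs.1.le _) (sub_nonneg.2 hs.2))),
    ← intervalIntegral.integral_of_le hy, hval]
  have e1 : (k : ℝ≥0∞) + 1 = ENNReal.ofReal (k + 1) := by
    rw [ENNReal.ofReal_add (by positivity) (by positivity)]; simp
  have e2 : (k : ℝ≥0∞) + 2 = ENNReal.ofReal (k + 2) := by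
    rw [ENNReal.ofReal_add (by positivity) (by positivity)]; simp
  rw [e1, e2, ← ENNReal.ofReal_mul (by positivity), ← ENNReal.ofReal_mul (by positivity)]
  congr 1
  field_simp

/-- The level-set inequality is integrated against `s^k ds`: the left side becomes the moment of
order `k + 2` by the Beta integral above, the right side that of order `k + 1` by the layer-cake
formula. -/
theorem lintegral_enorm_pow_succ_le {f : α → E} {μ : Measure α} [IsFiniteMeasure μ]
    (hf : AEStronglyMeasurable f μ) (k : ℕ) :
    ∫⁻ x, ‖f x‖ₑ ^ (k + 2) ∂μ ≤ (k + 2) * (oscNorm f μ * ∫⁻ x, ‖f x‖ₑ ^ (k + 1) ∂μ) := by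
  have hn := hf.norm.aemeasurable
  have hpow : ∀ (x : α) (m : ℕ), ‖f x‖ₑ ^ m = ENNReal.ofReal (‖f x‖ ^ m) := fun x m => by
    rw [ENNReal.ofReal_pow (norm_nonneg _), ofReal_norm]
  have hF : AEMeasurable (fun p : α × ℝ =>
      ENNReal.ofReal (p.2 ^ k) * ENNReal.ofReal (‖f p.1‖ - p.2))
      (μ.prod (volume.restrict (Set.Ioi 0))) := by
    have h1 : AEMeasurable (fun p : α × ℝ => ‖f p.1‖) (μ.prod (volume.restrict (Set.Ioi 0))) :=
      hn.comp_quasiMeasurePreserving Measure.quasiMeasurePreserving_fst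
    fun_prop
  have hF' : AEMeasurable (fun x =>
      ∫⁻ s in Set.Ioi (0 : ℝ), ENNReal.ofReal (s ^ k) * ENNReal.ofReal (‖f x‖ - s)) μ :=
    hF.lintegral_prod_right'
  have hlay : ∫⁻ x, ‖f x‖ₑ ^ (k + 1) ∂μ = (k + 1) *
      ∫⁻ s in Set.Ioi (0 : ℝ), μ {x | s < ‖f x‖} * ENNReal.ofReal (s ^ k) := by
    have h := lintegral_rpow_eq_lintegral_meas_lt_mul μ (f := fun x => ‖f x‖)
      (ae_of_all _ fun _ => norm_nonneg _) hn (p := k + 1) (by positivity)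
    rw [add_sub_cancel_right, ENNReal.ofReal_add (by positivity) (by positivity)] at h
    simp only [Real.rpow_natCast, ENNReal.ofReal_natCast, ENNReal.ofReal_one] at h
    rw [← h]
    refine lintegral_congr fun x => ?_
    rw [hpow, ← Real.rpow_natCast]
    push_cast
    rfl
  calc ∫⁻ x, ‖f x‖ₑ ^ (k + 2) ∂μ
      = (k + 2) * ((k + 1) * ∫⁻ x, (∫⁻ s in Set.Ioi (0 : ℝ),
          ENNReal.ofReal (s ^ k) * ENNReal.ofReal (‖f x‖ - s)) ∂μ) := by
        rw [← lintegral_const_mul'' _ hF', ← lintegral_const_mul'' _ (hF'.const_mul _)]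
        refine lintegral_congr fun x => ?_
        rw [hpow, lintegral_pow_mul_ofReal_sub (norm_nonneg _)]
    _ = (k + 2) * ((k + 1) * ∫⁻ s in Set.Ioi (0 : ℝ), ENNReal.ofReal (s ^ k) *
          ∫⁻ x, ENNReal.ofReal (‖f x‖ - s) ∂μ) := by
        rw [lintegral_lintegral_swap hF]
        congr 2
        refine lintegral_congr fun s => ?_
        rw [lintegral_const_mul'' _ (by fun_prop)]
    _ ≤ (k + 2) * ((k + 1) * ∫⁻ s in Set.Ioi (0 : ℝ), oscNorm f μ *
          (μ {x | s < ‖f x‖} * ENNReal.ofReal (s ^ k))) := by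
        gcongr (k + 2) * ((k + 1) * ?_)
        refine setLIntegral_mono' measurableSet_Ioi fun s hs => ?_
        rw [← mul_assoc, mul_comm]
        gcongr
        exact lintegral_ofReal_norm_sub_le hf (le_of_lt hs)
    _ = _ := by
        have hd : Measurable fun s : ℝ => μ {x | s < ‖f x‖} :=
          Antitone.measurable fun s t hst => measure_mono fun x hx => lt_of_le_of_lt hst hx
        have hd' : Measurable fun s : ℝ => μ {x | s < ‖f x‖} * ENNReal.ofReal (s ^ k) :=
          hd.mul (by fun_prop)
        rw [hlay, lintegral_const_mul _ hd']
        ring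

theorem lintegral_enorm_pow_le_factorial {f : α → E} {μ : Measure α} [IsFiniteMeasure μ]
    (hf : AEStronglyMeasurable f μ) (k : ℕ) :
    ∫⁻ x, ‖f x‖ₑ ^ (k + 1) ∂μ
      ≤ (k + 1).factorial * (oscNorm f μ ^ k * ∫⁻ x, ‖f x‖ₑ ∂μ) := by
  induction k with
  | zero => simp
  | succ k ih =>
    calc _ ≤ _ := lintegral_enorm_pow_succ_le hf k
      _ ≤ (k + 2) * (oscNorm f μ *
          ((k + 1).factorial * (oscNorm f μ ^ k * ∫⁻ x, ‖f x‖ₑ ∂μ))) := by gcongr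
      _ = _ := by
        rw [Nat.factorial_succ (k + 1), pow_succ]
        push_cast
        ring

/-! ### From integer moments to real exponents -/

theorem rpow_le_pow_floor_add_pow (y : ℝ≥0∞) {q : ℝ} (hq : 0 ≤ q) :
    y ^ q ≤ y ^ ⌊q⌋₊ + y ^ (⌊q⌋₊ + 1) := by
  rcases le_total y 1 with hy | hy
  · refine le_add_right ?_
    rw [← ENNReal.rpow_natCast]
    exact ENNReal.rpow_le_rpow_of_exponent_ge hy (Nat.floor_le hq)
  · refine le_add_left ?_
    rw [← ENNReal.rpow_natCast]
    refine ENNReal.rpow_le_rpow_of_exponent_le hy ?_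
    push_cast
    exact (Nat.lt_floor_add_one q).le

theorem factorial_floor_add_le {q : ℝ} (hq : 1 ≤ q) :
    ((⌊q⌋₊.factorial : ℝ≥0∞) + ((⌊q⌋₊ + 1).factorial : ℝ≥0∞))
      ≤ (4 * ENNReal.ofReal q) ^ q := by
  set k := ⌊q⌋₊
  have hk1 : 1 ≤ k := Nat.le_floor (by simpa using hq)
  have hkq : (k : ℝ) ≤ q := Nat.floor_le (by linarith)
  have h1 : k.factorial + (k + 1).factorial ≤ (4 * k) ^ k := by
    have e : k.factorial + (k + 1).factorial = (k + 2) * k.factorial := by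
      rw [Nat.factorial_succ]; ring
    -- The constant `4` absorbs the factor `k + 2`; this uses `k ≥ 1`.
    have h4 : k + 2 ≤ 4 ^ k := by
      have h2 : k + 1 < 2 ^ (k + 1) := Nat.lt_pow_self (by norm_num)
      calc k + 2 ≤ 2 ^ (k + 1) := h2
        _ ≤ 2 ^ (2 * k) := Nat.pow_le_pow_right (by norm_num) (by omega)
        _ = 4 ^ k := by rw [pow_mul]; norm_num
    rw [e, mul_pow]
    exact Nat.mul_le_mul h4 (Nat.factorial_le_pow k)
  have hkE : (k : ℝ≥0∞) ≤ ENNReal.ofReal q := by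
    rw [← ENNReal.ofReal_natCast]
    exact ENNReal.ofReal_le_ofReal hkq
  have h1q : (1 : ℝ≥0∞) ≤ 4 * ENNReal.ofReal q :=
    calc (1 : ℝ≥0∞) ≤ 4 * 1 := by norm_num
      _ ≤ 4 * ENNReal.ofReal q := by gcongr; simpa using hq
  calc (k.factorial : ℝ≥0∞) + ((k + 1).factorial : ℝ≥0∞) ≤ (4 * k) ^ k := by exact_mod_cast h1
    _ ≤ (4 * ENNReal.ofReal q) ^ k := by gcongr
    _ = (4 * ENNReal.ofReal q) ^ (k : ℝ) := (ENNReal.rpow_natCast _ _).symm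
    _ ≤ _ := ENNReal.rpow_le_rpow_of_exponent_le h1q hkq

theorem eLpNorm_ofReal_eq (f : α → E) (μ : Measure α) {q : ℝ} (hq : 0 < q) :
    eLpNorm f (ENNReal.ofReal q) μ = (∫⁻ x, ‖f x‖ₑ ^ q ∂μ) ^ (1 / q) := by
  rw [eLpNorm_eq_lintegral_rpow_enorm_toReal (by simpa using hq) ENNReal.ofReal_ne_top,
    ENNReal.toReal_ofReal hq.le]

/-- Factorial growth of the integer moments implies linear growth of the `L^q` norms. -/
theorem eLpNorm_le_of_lintegral_pow_le {f : α → E} {μ : Measure α}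
    (hf : AEStronglyMeasurable f μ) {B C : ℝ≥0∞} (hC0 : C ≠ 0) (hC : C ≠ ⊤)
    (h : ∀ k : ℕ, ∫⁻ x, (‖f x‖ₑ / C) ^ (k + 1) ∂μ ≤ (k + 1).factorial * B)
    {q : ℝ} (hq : 1 ≤ q) :
    eLpNorm f (ENNReal.ofReal q) μ ≤ 4 * ENNReal.ofReal q * C * B ^ (1 / q) := by
  have hq0 : 0 < q := by linarith
  obtain ⟨m, hm⟩ : ∃ m, ⌊q⌋₊ = m + 1 :=
    Nat.exists_eq_succ_of_ne_zero (Nat.floor_pos.2 hq).ne'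
  have hg : AEMeasurable (fun x => ‖f x‖ₑ / C) μ := hf.enorm.div_const C
  have h1 : ∫⁻ x, (‖f x‖ₑ / C) ^ q ∂μ ≤ (4 * ENNReal.ofReal q) ^ q * B :=
    calc ∫⁻ x, (‖f x‖ₑ / C) ^ q ∂μ
        ≤ ∫⁻ x, ((‖f x‖ₑ / C) ^ ⌊q⌋₊ + (‖f x‖ₑ / C) ^ (⌊q⌋₊ + 1)) ∂μ :=
          lintegral_mono fun x => rpow_le_pow_floor_add_pow _ hq0.le
      _ = ∫⁻ x, (‖f x‖ₑ / C) ^ ⌊q⌋₊ ∂μ + ∫⁻ x, (‖f x‖ₑ / C) ^ (⌊q⌋₊ + 1) ∂μ :=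
          lintegral_add_left' (hg.pow_const _) _
      _ ≤ ⌊q⌋₊.factorial * B + (⌊q⌋₊ + 1).factorial * B := by
          refine add_le_add ?_ (h _)
          rw [hm]
          exact h m
      _ ≤ _ := by
          rw [← add_mul]
          gcongr
          exact factorial_floor_add_le hq
  have h2 : ∫⁻ x, ‖f x‖ₑ ^ q ∂μ = C ^ q * ∫⁻ x, (‖f x‖ₑ / C) ^ q ∂μ := by
    rw [← lintegral_const_mul'' _ (hg.pow_const _)]
    refine lintegral_congr fun x => ?_
    rw [← ENNReal.mul_rpow_of_nonneg _ _ hq0.le, ENNReal.mul_div_cancel hC0 hC]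
  rw [eLpNorm_ofReal_eq f μ hq0, h2]
  calc (C ^ q * ∫⁻ x, (‖f x‖ₑ / C) ^ q ∂μ) ^ (1 / q)
      ≤ (C ^ q * ((4 * ENNReal.ofReal q) ^ q * B)) ^ (1 / q) := by gcongr
    _ = C * (4 * ENNReal.ofReal q) * B ^ (1 / q) := by
      rw [← mul_assoc, ← ENNReal.mul_rpow_of_nonneg _ _ hq0.le,
        ENNReal.mul_rpow_of_nonneg _ _ (by positivity), ← ENNReal.rpow_mul,
        mul_one_div_cancel hq0.ne', ENNReal.rpow_one]
    _ = _ := by ring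

theorem eLpNorm_eq_zero_of_eLpNorm_one_eq_zero {f : α → E} {μ : Measure α}
    (hf : AEStronglyMeasurable f μ) (h : eLpNorm f 1 μ = 0) (p : ℝ≥0∞) : eLpNorm f p μ = 0 := by
  rw [eLpNorm_congr_ae ((eLpNorm_eq_zero_iff hf one_ne_zero).1 h), eLpNorm_zero]

theorem eLpNorm_one_le_oscNorm {f : α → E} {μ : Measure α} [IsFiniteMeasure μ]
    (hf : AEStronglyMeasurable f μ) : eLpNorm f 1 μ ≤ μ Set.univ * oscNorm f μ := by
  rw [eLpNorm_one_eq_lintegral_enorm]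
  exact lintegral_enorm_le_oscNorm hf

theorem eLpNorm_le_eLpNorm_one_mul_oscNorm {f : α → E} {μ : Measure α} [IsFiniteMeasure μ]
    (hf : AEStronglyMeasurable f μ) {q : ℝ} (hq : 1 < q) :
    eLpNorm f (ENNReal.ofReal q) μ
      ≤ 4 * ENNReal.ofReal q * eLpNorm f 1 μ ^ (1 / q) * oscNorm f μ ^ (1 - 1 / q) := by
  have hq0 : 0 < q := by linarith
  have hq1 : 0 < 1 - 1 / q := by
    rw [sub_pos, div_lt_one hq0]
    exact hq
  rcases eq_or_ne (eLpNorm f 1 μ) 0 with h0 | h0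
  · rw [eLpNorm_eq_zero_of_eLpNorm_one_eq_zero hf h0]
    exact bot_le
  set W := oscNorm f μ with hW
  have hW0 : W ≠ 0 := fun h => h0 <| by
    have := eLpNorm_one_le_oscNorm hf
    rw [← hW, h, mul_zero] at this
    exact le_antisymm this bot_le
  -- If `W = ∞`, the right side is infinite, since `1 - 1/q > 0` and `‖f‖₁ ≠ 0`.
  rcases eq_or_ne W ⊤ with hWt | hWt
  · rw [hWt, ENNReal.top_rpow_of_pos hq1, ENNReal.mul_top]
    · exact le_top
    · refine mul_ne_zero (mul_ne_zero (by norm_num) (by simpa using hq0)) ?_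
      simp [ENNReal.rpow_eq_zero_iff, h0, hq0.le]
  -- Normalising by `C = W` leaves the mass `B = ‖f‖₁ / W`, and `C B^(1/q)` is the claimed geometric
  -- mean.
  have key := eLpNorm_le_of_lintegral_pow_le hf hW0 hWt (B := eLpNorm f 1 μ / W) (fun k => ?_) hq.le
  · refine key.trans (le_of_eq ?_)
    rw [ENNReal.div_rpow_of_nonneg _ _ (by positivity), ENNReal.rpow_sub _ _ hW0 hWt,
      ENNReal.rpow_one]
    simp only [div_eq_mul_inv]
    ring
  · simp only [div_eq_mul_inv, mul_pow]
    rw [lintegral_mul_const'' _ (hf.enorm.pow_const _), eLpNorm_one_eq_lintegral_enorm]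
    calc _ ≤ ((k + 1).factorial * (W ^ k * ∫⁻ x, ‖f x‖ₑ ∂μ)) * W⁻¹ ^ (k + 1) := by
          gcongr
          exact lintegral_enorm_pow_le_factorial hf k
      _ = (k + 1).factorial * ((∫⁻ x, ‖f x‖ₑ ∂μ) * W⁻¹) * (W * W⁻¹) ^ k := by
          rw [pow_succ, mul_pow]
          ring
      _ = _ := by rw [ENNReal.mul_inv_cancel hW0 hWt, one_pow, mul_one]

theorem eLpNorm_le_measure_rpow_mul_oscNorm {f : α → E} {μ : Measure α} [IsFiniteMeasure μ]
    (hf : AEStronglyMeasurable f μ) {q : ℝ} (hq : 1 < q) :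
    eLpNorm f (ENNReal.ofReal q) μ
      ≤ 4 * ENNReal.ofReal q * μ Set.univ ^ (1 / q) * oscNorm f μ := by
  have hq0 : 0 < q := by linarith
  have hq1 : 0 ≤ 1 - 1 / q := by
    rw [sub_nonneg, div_le_one hq0]
    exact hq.le
  calc _ ≤ 4 * ENNReal.ofReal q * eLpNorm f 1 μ ^ (1 / q) * oscNorm f μ ^ (1 - 1 / q) :=
        eLpNorm_le_eLpNorm_one_mul_oscNorm hf hq
    _ ≤ 4 * ENNReal.ofReal q * (μ Set.univ * oscNorm f μ) ^ (1 / q)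
          * oscNorm f μ ^ (1 - 1 / q) := by
        gcongr
        exact eLpNorm_one_le_oscNorm hf
    _ = 4 * ENNReal.ofReal q * μ Set.univ ^ (1 / q)
          * (oscNorm f μ ^ (1 / q) * oscNorm f μ ^ (1 - 1 / q)) := by
        rw [ENNReal.mul_rpow_of_nonneg _ _ (by positivity)]
        ring
    _ = _ := by
        rw [← ENNReal.rpow_add_of_nonneg _ _ (by positivity) hq1, add_sub_cancel,
          ENNReal.rpow_one]

theorem eLpNorm_le_max_mul_oscNorm {f : α → E} {μ : Measure α} [IsFiniteMeasure μ]
    (hf : AEStronglyMeasurable f μ) {q : ℝ} (hq : 1 < q) :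
    eLpNorm f (ENNReal.ofReal q) μ
      ≤ (4 * max 1 (μ Set.univ)) * ENNReal.ofReal q * oscNorm f μ := by
  have hq0 : 0 < q := by linarith
  have h : μ Set.univ ^ (1 / q) ≤ max 1 (μ Set.univ) :=
    calc μ Set.univ ^ (1 / q) ≤ max 1 (μ Set.univ) ^ (1 / q) := by
          gcongr
          exact le_max_right _ _
      _ ≤ max 1 (μ Set.univ) ^ (1 : ℝ) :=
          ENNReal.rpow_le_rpow_of_exponent_le (le_max_left _ _) ((div_le_one hq0).2 hq.le)
      _ = _ := ENNReal.rpow_one _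
  calc _ ≤ _ := eLpNorm_le_measure_rpow_mul_oscNorm hf hq
    _ ≤ 4 * ENNReal.ofReal q * max 1 (μ Set.univ) * oscNorm f μ := by gcongr
    _ = _ := by ring

/-! ### The extrapolation norm and the exponential class -/

theorem extrapolationNorm_le_of_eLpNorm_le {f : α → E} {μ : Measure α} {D : ℝ≥0∞}
    (h : ∀ q : ℝ, 1 < q → eLpNorm f (ENNReal.ofReal q) μ ≤ D * ENNReal.ofReal q) :
    extrapolationNorm f μ ≤ D := by
  refine iSup₂_le fun q hq => ?_
  rw [ENNReal.div_le_iff (by simpa using (zero_lt_one.trans hq)) ENNReal.ofReal_ne_top]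
  exact h q hq

theorem eLpNorm_le_mul_extrapolationNorm (f : α → E) (μ : Measure α) {q : ℝ} (hq : 1 < q) :
    eLpNorm f (ENNReal.ofReal q) μ ≤ ENNReal.ofReal q * extrapolationNorm f μ := by
  rw [mul_comm, ← ENNReal.div_le_iff (by simpa using (zero_lt_one.trans hq)) ENNReal.ofReal_ne_top]
  exact le_iSup₂_of_le q hq le_rfl

/-- The exponent `1` is excluded from the supremum but is needed for the linear Taylor term. It is
reached by Hölder's inequality as `q → 1⁺`, the factor `q μ(univ)^(1 - 1/q)` tending to `1`. -/
theorem eLpNorm_one_le_extrapolationNorm {f : α → E} {μ : Measure α} [IsFiniteMeasure μ]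
    (hf : AEStronglyMeasurable f μ) : eLpNorm f 1 μ ≤ extrapolationNorm f μ := by
  rcases eq_or_ne (μ Set.univ) 0 with h0 | h0
  · simp [Measure.measure_univ_eq_zero.1 h0]
  rcases eq_or_ne (extrapolationNorm f μ) ⊤ with hS | hS
  · simp [hS]
  have hlim : Filter.Tendsto (fun q : ℝ => ENNReal.ofReal q * extrapolationNorm f μ
      * μ Set.univ ^ (1 - 1 / q)) (nhdsWithin 1 (Set.Ioi 1))
      (nhds (ENNReal.ofReal 1 * extrapolationNorm f μ * μ Set.univ ^ (1 - 1 / (1 : ℝ)))) := by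
    have h1 : Filter.Tendsto (fun q : ℝ => ENNReal.ofReal q * extrapolationNorm f μ)
        (nhds 1) (nhds (ENNReal.ofReal 1 * extrapolationNorm f μ)) :=
      ENNReal.Tendsto.mul_const (ENNReal.continuous_ofReal.tendsto 1) (Or.inr hS)
    have h2 : Filter.Tendsto (fun q : ℝ => μ Set.univ ^ (1 - 1 / q))
        (nhds 1) (nhds (μ Set.univ ^ (1 - 1 / (1 : ℝ)))) := by
      have e : ∀ r : ℝ, μ Set.univ ^ r = ENNReal.ofReal ((μ Set.univ).toReal ^ r) := fun r => by
        rw [← ENNReal.ofReal_rpow_of_pos (ENNReal.toReal_pos h0 (measure_ne_top _ _)),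
          ENNReal.ofReal_toReal (measure_ne_top _ _)]
      simp only [e]
      refine (ENNReal.continuous_ofReal.tendsto _).comp ?_
      refine Filter.Tendsto.rpow tendsto_const_nhds ?_
        (Or.inl (ENNReal.toReal_pos h0 (measure_ne_top _ _)).ne')
      exact tendsto_const_nhds.sub (tendsto_const_nhds.div Filter.tendsto_id one_ne_zero)
    refine (ENNReal.Tendsto.mul h1 (Or.inr ?_) h2 (Or.inr ?_)).mono_left nhdsWithin_le_nhds
    · simp
    · simpa using hS
  simp only [ENNReal.ofReal_one, one_mul, div_one, sub_self, ENNReal.rpow_zero, mul_one] at hlim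
  refine ge_of_tendsto hlim ?_
  filter_upwards [self_mem_nhdsWithin] with q hq
  have hq' : (1 : ℝ) < q := hq
  have h := eLpNorm_le_eLpNorm_mul_rpow_measure_univ (p := 1) (q := ENNReal.ofReal q)
    (by simpa using hq'.le) hf
  rw [ENNReal.toReal_one, ENNReal.toReal_ofReal (by linarith), div_one] at h
  refine h.trans ?_
  gcongr
  exact eLpNorm_le_mul_extrapolationNorm f μ hq'

theorem lintegral_enorm_pow_le_extrapolationNorm {f : α → E} {μ : Measure α} [IsFiniteMeasure μ]
    (hf : AEStronglyMeasurable f μ) (k : ℕ) :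
    ∫⁻ x, ‖f x‖ₑ ^ (k + 1) ∂μ ≤ ((k + 1 : ℕ) * extrapolationNorm f μ) ^ (k + 1) := by
  rcases Nat.eq_zero_or_pos k with rfl | hk
  · simpa [← eLpNorm_one_eq_lintegral_enorm] using eLpNorm_one_le_extrapolationNorm hf
  have hk1 : (1 : ℝ) < (k + 1 : ℕ) := by exact_mod_cast Nat.succ_lt_succ hk
  have hk0 : (0 : ℝ) < (k + 1 : ℕ) := by linarith
  have h := eLpNorm_le_mul_extrapolationNorm f μ hk1
  rw [eLpNorm_ofReal_eq f μ hk0, one_div, ENNReal.rpow_inv_le_iff hk0] at h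
  simpa only [ENNReal.rpow_natCast, ENNReal.ofReal_natCast] using h

theorem ofReal_exp_sub_one_eq_tsum {y : ℝ} (hy : 0 ≤ y) :
    ENNReal.ofReal (Real.exp y - 1)
      = ∑' k : ℕ, ENNReal.ofReal (y ^ (k + 1) / (k + 1).factorial) := by
  have hs : HasSum (fun k : ℕ => y ^ (k + 1) / (k + 1).factorial) (Real.exp y - 1) := by
    have h := NormedSpace.expSeries_div_hasSum_exp y
    rw [← Real.exp_eq_exp_ℝ] at h
    simpa using (hasSum_nat_add_iff' 1).2 h
  rw [← hs.tsum_eq, ENNReal.ofReal_tsum_of_nonneg (fun k => by positivity) hs.summable]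

theorem expNorm_le_extrapolationNorm {f : α → E} {μ : Measure α} [IsFiniteMeasure μ]
    (hf : AEStronglyMeasurable f μ) : expNorm f μ ≤ 6 * extrapolationNorm f μ := by
  rcases eq_or_ne (extrapolationNorm f μ) ⊤ with hS | hS
  · simp [hS]
  -- Any positive `k ≥ 6 S`, with `S` the extrapolation norm, is admissible. The value `6 S` itself
  -- is approached from above at the end, as it may be zero.
  have key : ∀ k : ℝ, 0 < k → 6 * extrapolationNorm f μ ≤ ENNReal.ofReal k →
      expNorm f μ ≤ ENNReal.ofReal k := by
    intro k hk hSk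
    refine iInf₂_le_of_le k ⟨hk, ?_⟩ le_rfl
    have hk0 : ENNReal.ofReal k ≠ 0 := by simpa using hk
    have hterm : ∀ j : ℕ, ∫⁻ x, ENNReal.ofReal ((‖f x‖ / k) ^ (j + 1) / (j + 1).factorial) ∂μ
        ≤ 2⁻¹ ^ (j + 1) := by
      intro j
      have e : ∀ x, ENNReal.ofReal ((‖f x‖ / k) ^ (j + 1) / (j + 1).factorial)
          = ‖f x‖ₑ ^ (j + 1) * ((ENNReal.ofReal k)⁻¹ ^ (j + 1)
            * ((j + 1).factorial : ℝ≥0∞)⁻¹) := fun x => by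
        rw [ENNReal.ofReal_div_of_pos (by positivity), ENNReal.ofReal_pow (by positivity),
          ENNReal.ofReal_div_of_pos hk, ofReal_norm, ENNReal.ofReal_natCast, div_eq_mul_inv,
          div_eq_mul_inv, mul_pow, mul_assoc]
      simp only [e]
      rw [lintegral_mul_const'' _ (hf.enorm.pow_const _)]
      -- `m^m / m! ≤ e^m ≤ 3^m`. With `k ≥ 6 S` the term of order `m` is then at most `(3 S / k)^m ≤
      -- 2^(-m)`, and these sum over `m ≥ 1` to exactly `1`.
      have hfac : ((j + 1 : ℕ) : ℝ≥0∞) ^ (j + 1) * ((j + 1).factorial : ℝ≥0∞)⁻¹ ≤ 3 ^ (j + 1) := by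
        have hr := Real.pow_div_factorial_le_exp (x := ((j + 1 : ℕ) : ℝ)) (by positivity) (j + 1)
        have he : Real.exp ((j + 1 : ℕ) : ℝ) ≤ 3 ^ (j + 1) := by
          rw [← mul_one ((j + 1 : ℕ) : ℝ), Real.exp_nat_mul]
          gcongr
          linarith [Real.exp_one_lt_d9]
        have h3 := ENNReal.ofReal_le_ofReal (hr.trans he)
        rw [ENNReal.ofReal_div_of_pos (by positivity), ENNReal.ofReal_pow (by positivity),
          ENNReal.ofReal_pow (by positivity), ENNReal.ofReal_natCast, ENNReal.ofReal_natCast,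
          div_eq_mul_inv] at h3
        simpa using h3
      have hS3 : 3 * (extrapolationNorm f μ * (ENNReal.ofReal k)⁻¹) ≤ 2⁻¹ := by
        rw [ENNReal.le_inv_iff_mul_le]
        calc 3 * (extrapolationNorm f μ * (ENNReal.ofReal k)⁻¹) * 2
            = (6 * extrapolationNorm f μ) * (ENNReal.ofReal k)⁻¹ := by
              rw [show (6 : ℝ≥0∞) = 3 * 2 by norm_num]
              ring
          _ ≤ ENNReal.ofReal k * (ENNReal.ofReal k)⁻¹ := by gcongr
          _ = 1 := ENNReal.mul_inv_cancel hk0 ENNReal.ofReal_ne_top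
      calc _ ≤ ((j + 1 : ℕ) * extrapolationNorm f μ) ^ (j + 1)
            * ((ENNReal.ofReal k)⁻¹ ^ (j + 1) * ((j + 1).factorial : ℝ≥0∞)⁻¹) := by
            gcongr
            exact lintegral_enorm_pow_le_extrapolationNorm hf j
        _ = (((j + 1 : ℕ) : ℝ≥0∞) ^ (j + 1) * ((j + 1).factorial : ℝ≥0∞)⁻¹)
            * (extrapolationNorm f μ * (ENNReal.ofReal k)⁻¹) ^ (j + 1) := by
            rw [mul_pow, mul_pow]
            ring
        _ ≤ 3 ^ (j + 1) * (extrapolationNorm f μ * (ENNReal.ofReal k)⁻¹) ^ (j + 1) := by gcongr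
        _ ≤ 2⁻¹ ^ (j + 1) := by
            rw [← mul_pow]
            gcongr
    calc ∫⁻ x, ENNReal.ofReal (Real.exp (‖f x‖ / k) - 1) ∂μ
        = ∫⁻ x, ∑' j : ℕ, ENNReal.ofReal ((‖f x‖ / k) ^ (j + 1) / (j + 1).factorial) ∂μ :=
          lintegral_congr fun x => ofReal_exp_sub_one_eq_tsum (by positivity)
      _ = ∑' j : ℕ, ∫⁻ x, ENNReal.ofReal ((‖f x‖ / k) ^ (j + 1) / (j + 1).factorial) ∂μ :=
          lintegral_tsum fun j =>
            ((((hf.norm.aemeasurable.div_const k).pow_const _).div_const _).ennreal_ofReal)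
      _ ≤ ∑' j : ℕ, 2⁻¹ ^ (j + 1) := ENNReal.tsum_le_tsum hterm
      _ = 1 := by
          rw [ENNReal.tsum_geometric_add_one, ENNReal.one_sub_inv_two, inv_inv,
            ENNReal.inv_mul_cancel (by norm_num) (by norm_num)]
  refine le_of_forall_gt_imp_ge_of_dense fun r hr => ?_
  rcases eq_or_ne r ⊤ with rfl | hrt
  · exact le_top
  have hr0 : r ≠ 0 := (bot_le.trans_lt hr).ne'
  have h := key r.toReal (ENNReal.toReal_pos hr0 hrt) (by rw [ENNReal.ofReal_toReal hrt]; exact hr.le)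
  rwa [ENNReal.ofReal_toReal hrt] at h

theorem extrapolationNorm_le_expNorm {f : α → E} {μ : Measure α}
    (hf : AEStronglyMeasurable f μ) : extrapolationNorm f μ ≤ 4 * expNorm f μ := by
  rw [mul_comm, ← ENNReal.div_le_iff (by norm_num) (by norm_num)]
  refine le_iInf₂ fun k hk => ?_
  obtain ⟨hk, hint⟩ := hk
  rw [ENNReal.div_le_iff (by norm_num) (by norm_num)]
  refine extrapolationNorm_le_of_eLpNorm_le fun q hq => ?_
  -- Each Taylor term satisfies `y^m / m! ≤ e^y - 1`, so the moments of `|f| / k` are at most `m!`.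
  have h := eLpNorm_le_of_lintegral_pow_le hf (B := 1) (C := ENNReal.ofReal k) (by simpa using hk)
    ENNReal.ofReal_ne_top (fun j => ?_) hq.le
  · refine h.trans (le_of_eq ?_)
    rw [ENNReal.one_rpow]
    ring
  · refine le_trans ?_ (mul_le_mul_right hint _)
    rw [← lintegral_const_mul' _ _ (ENNReal.natCast_ne_top _)]
    refine lintegral_mono fun x => ?_
    have hy : 0 ≤ ‖f x‖ / k := by positivity
    rw [ofReal_exp_sub_one_eq_tsum hy]
    calc (‖f x‖ₑ / ENNReal.ofReal k) ^ (j + 1)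
        = (j + 1).factorial * ENNReal.ofReal ((‖f x‖ / k) ^ (j + 1) / (j + 1).factorial) := by
          rw [← ofReal_norm, ← ENNReal.ofReal_div_of_pos hk, ← ENNReal.ofReal_pow hy,
            ← ENNReal.ofReal_natCast, ← ENNReal.ofReal_mul (by positivity)]
          congr 1
          field_simp
      _ ≤ _ := by
          gcongr
          exact ENNReal.le_tsum j

theorem extrapolationNorm_le_oscNorm {f : α → E} {μ : Measure α} [IsFiniteMeasure μ]
    (hf : AEStronglyMeasurable f μ) :
    extrapolationNorm f μ ≤ (4 * max 1 (μ Set.univ)) * oscNorm f μ :=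
  extrapolationNorm_le_of_eLpNorm_le fun q hq =>
    (eLpNorm_le_max_mul_oscNorm hf hq).trans (le_of_eq (by ring))

theorem expNorm_le_oscNorm {f : α → E} {μ : Measure α} [IsFiniteMeasure μ]
    (hf : AEStronglyMeasurable f μ) :
    expNorm f μ ≤ (24 * max 1 (μ Set.univ)) * oscNorm f μ :=
  calc expNorm f μ ≤ 6 * ((4 * max 1 (μ Set.univ)) * oscNorm f μ) :=
        (expNorm_le_extrapolationNorm hf).trans (by gcongr; exact extrapolationNorm_le_oscNorm hf)
    _ = _ := by
        rw [show (24 : ℝ≥0∞) = 6 * 4 by norm_num]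
        ring

/-! ### Specialisation to cubes -/

theorem volume_cube_lt_top {n : ℕ} (a : EuclideanSpace ℝ (Fin n)) (ℓ : ℝ) :
    volume (cube a ℓ) < ⊤ := by
  have h : cube a ℓ = (WithLp.ofLp : EuclideanSpace ℝ (Fin n) → Fin n → ℝ) ⁻¹'
      Set.Icc (fun i => a i) (fun i => a i + ℓ) := by
    ext x
    simp only [cube, Set.mem_preimage, Set.mem_Icc, Pi.le_def, Set.mem_ofPred_eq]
    exact forall_and
  rw [h, (PiLp.volume_preserving_ofLp (Fin n)).measure_preimage
    measurableSet_Icc.nullMeasurableSet]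
  exact measure_Icc_lt_top

end Oscillation

theorem mainTheorem4 {𝕜 : Type*} [RCLike 𝕜] :
    ∃ c : ℝ≥0, ∀ (n : ℕ) (a : EuclideanSpace ℝ (Fin n)) (ℓ : ℝ), 0 < ℓ →
      ∀ (Q : Set (EuclideanSpace ℝ (Fin n))), Q = Oscillation.cube a ℓ →
      ∀ f : EuclideanSpace ℝ (Fin n) → 𝕜, AEStronglyMeasurable f (volume.restrict Q) →
        -- `‖f‖_{L¹} ≤ |Q| ‖f‖_{L(∞,∞)}`
        eLpNorm f 1 (volume.restrict Q)
            ≤ volume Q * Oscillation.oscNorm f (volume.restrict Q) ∧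
        -- the bounds for `‖f‖_{L^q}`, `q > 1`
        (∀ q : ℝ, 1 < q →
          eLpNorm f (ENNReal.ofReal q) (volume.restrict Q)
              ≤ c * ENNReal.ofReal q * eLpNorm f 1 (volume.restrict Q) ^ (1 / q)
                * Oscillation.oscNorm f (volume.restrict Q) ^ (1 - 1 / q) ∧
          eLpNorm f (ENNReal.ofReal q) (volume.restrict Q)
              ≤ c * ENNReal.ofReal q * volume Q ^ (1 / q)
                * Oscillation.oscNorm f (volume.restrict Q) ∧
          eLpNorm f (ENNReal.ofReal q) (volume.restrict Q)
              ≤ (c * max 1 (volume Q)) * ENNReal.ofReal q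
                * Oscillation.oscNorm f (volume.restrict Q)) ∧
        -- `‖f‖_{e^L} ≈ sup_q ‖f‖_{L^q} / q`
        Oscillation.expNorm f (volume.restrict Q)
            ≤ c * Oscillation.extrapolationNorm f (volume.restrict Q) ∧
        Oscillation.extrapolationNorm f (volume.restrict Q)
            ≤ c * Oscillation.expNorm f (volume.restrict Q) ∧
        -- the bounds for `sup_q ‖f‖_{L^q} / q` and for `‖f‖_{e^L}`
        Oscillation.extrapolationNorm f (volume.restrict Q)
            ≤ (c * max 1 (volume Q)) * Oscillation.oscNorm f (volume.restrict Q) ∧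
        Oscillation.expNorm f (volume.restrict Q)
            ≤ (c * max 1 (volume Q)) * Oscillation.oscNorm f (volume.restrict Q) := by
  -- `24 = 6 * 4`, the largest of the constants, comes from chaining the last two bounds through the
  -- extrapolation norm.
  refine ⟨24, fun n a ℓ _ Q hQ f hf => ?_⟩
  have hfin : IsFiniteMeasure (volume.restrict Q) := by
    refine ⟨?_⟩
    rw [Measure.restrict_apply_univ, hQ]
    exact Oscillation.volume_cube_lt_top a ℓ
  have hc : (4 : ℝ≥0∞) ≤ ((24 : ℝ≥0) : ℝ≥0∞) := by norm_num
  have hc' : (6 : ℝ≥0∞) ≤ ((24 : ℝ≥0) : ℝ≥0∞) := by norm_num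
  rw [← Measure.restrict_apply_univ (μ := volume) Q]
  refine ⟨Oscillation.eLpNorm_one_le_oscNorm hf, fun q hq => ⟨?_, ?_, ?_⟩, ?_, ?_, ?_, ?_⟩
  · exact (Oscillation.eLpNorm_le_eLpNorm_one_mul_oscNorm hf hq).trans (by gcongr)
  · exact (Oscillation.eLpNorm_le_measure_rpow_mul_oscNorm hf hq).trans (by gcongr)
  · exact (Oscillation.eLpNorm_le_max_mul_oscNorm hf hq).trans (by gcongr)
  · exact (Oscillation.expNorm_le_extrapolationNorm hf).trans (by gcongr)
  · exact (Oscillation.extrapolationNorm_le_expNorm hf).trans (by gcongr)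
  · exact (Oscillation.extrapolationNorm_le_oscNorm hf).trans (by gcongr)
  · exact_mod_cast Oscillation.expNorm_le_oscNorm hf
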